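/- **Setting.** Let $\|\cdot\|$ be an arbitrary norm on $\mathbb R^n$ with dual norm $\|\cdot\|_*$. Consider $$\Psi^*=\min_{x\in X}\Big\{\Psi(x):=\sum_{i=1}^m f_i(x)+h(x)+\mu\,\omega(x)\Big\},\qquad \mu>0,$$ where $X\subseteq\mathbb R^n$ is closed and convex, $h$ is convex on $X$, $\omega$ is strongly convex on $X$ with modulus $1$ with respect to $\|\cdot\|$, each $f_i:\mathbb R^n\to\mathbb R$ is convex and differentiable with $\|\nabla f_i(x)-\nabla f_i(z)\|_*\le L_i\|x-z\|$ for all $x,z\in\mathbb R^n$ ($L_i\ge 0$), and $L_f\ge 0$ is a Lipschitz constant, in the same sense, of $\nabla\big(\sum_i f_i\big)$. Let $x^*\in X$ be an optimal solution. If $m=1$, assume that $L_1>0$. For a selected subgradient $\omega'(x)\in\partial\omega(x)$ put $P(x,z)=\omega(z)-\omega(x)-\langle\omega'(x),z-x\rangle$. Let $J_i$ be the convex conjugate of $f_i$, with domain $\mathcal Y_i$, and for a selected $J_i'(y^0)\in\partial J_i(y^0)$ put $D_i(y^0,y)=J_i(y)-J_i(y^0)-\langle J_i'(y^0),y-y^0\rangle$.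 **The RPDG method** with parameters $p_i,\tau,\eta,\alpha$. Start with $x^{-1}=x^0\in X$, some $\omega'(x^0)\in\partial\omega(x^0)$, $y_i^0=\nabla f_i(x^0)$ and $\underline x_i^0=x^0$. For $t=1,2,\dots$, draw $i_t$, independently of the earlier draws, with $\mathrm{Prob}\{i_t=i\}=p_i$, set $\tilde x^t=\alpha(x^{t-1}-x^{t-2})+x^{t-1}$, and for $i=i_t$ set $$y_i^t\in\operatorname*{argmin}_{y\in\mathcal Y_i}\{\langle-\tilde x^t,y\rangle+J_i(y)+\tau D_i(y_i^{t-1},y)\},\quad \underline x_i^t=\frac{\tilde x^t+\tau\underline x_i^{t-1}}{1+\tau},\quad \tilde y_i^t=p_i^{-1}(y_i^t-y_i^{t-1})+y_i^{t-1},$$ where the subgradient of $J_i$ selected at $y_i^{t}$ is $J_i'(y_i^{t})=\underline x_i^{t}$; for $i\ne i_t$ set $y_i^t=\tilde y_i^t=y_i^{t-1}$ and $\underline x_i^t=\underline x_i^{t-1}$. With $g=\sum_i\tilde y_i^t$ put $$x^t\in\operatorname*{argmin}_{x\in X}\{\langle g,x\rangle+h(x)+\mu\,\omega(x)+\eta P(x^{t-1},x)\}$$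 and select $\omega'(x^t)\in\partial\omega(x^t)$, depending only on $i_1,\dots,i_t$, such that for some $h'(x^t)\in\partial h(x^t)$ $$\langle g+h'(x^t)+(\mu+\eta)\omega'(x^t)-\eta\,\omega'(x^{t-1}),\,x-x^t\rangle\ge0\qquad\text{for all }x\in X.$$ Put $\bar x^k=\big(\sum_{t=1}^k\theta_t\big)^{-1}\sum_{t=1}^k\theta_t x^t$ with $\theta_t=\alpha^{-t}$. **Corollary 3.2.** Let $p_i=1/m$ for all $i$, $\bar C=\frac{4m}{\mu}\max_i L_i$, $S=\sqrt{(m-1)^2+4m\bar C}$ and $$\tau=\frac{S-(m-1)}{2m},\qquad \eta=\frac{\mu S+\mu(m-1)}{2},\qquad \alpha=1-\frac{2}{(m+1)+S}.$$ Then for every $k\ge1$ $$\mathbb E[P(x^k,x^*)]\le\Big(1+\frac{L_f}{\mu}\Big)\alpha^kP(x^0,x^*),$$ $$\mathbb E[\Psi(\bar x^k)-\Psi^*]\le\alpha^{k/2}(1-\alpha)^{-1}\Big(\mu+2L_f+\frac{L_f^2}{\mu}\Big)P(x^0,x^*).$$ Put $$K_u(\epsilon)=\frac{(m+1)+S}{2}\,\log\Big[\Big(1+\frac{L_f}{\mu}\Big)\frac{P(x^0,x^*)}{\epsilon}\Big],$$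 $$\tilde K(\epsilon)=2\big[(m+1)+S\big]\log\Big[2\Big(\mu+2L_f+\frac{L_f^2}{\mu}\Big)\big(m+\sqrt{m\bar C}\big)\frac{P(x^0,x^*)}{\epsilon}\Big],$$ both read as $0$ if $P(x^0,x^*)=0$. Then for all $\epsilon>0$ and $\lambda\in(0,1)$: 1. $\mathbb E[P(x^k,x^*)]\le\epsilon$ for every integer $k\ge0$ with $k\ge K_u(\epsilon)$, and $\mathrm{Prob}\{P(x^k,x^*)\le\epsilon\}\ge1-\lambda$ for every integer $k\ge0$ with $k\ge K_u(\lambda\epsilon)$. 2. $\mathbb E[\Psi(\bar x^k)-\Psi^*]\le\epsilon$ for every integer $k\ge1$ with $k\ge\tilde K(\epsilon)/2$, and $\mathrm{Prob}\{\Psi(\bar x^k)-\Psi^*\le\epsilon\}\ge1-\lambda$ for every integer $k\ge1$ with $k\ge\tilde K(\lambda\epsilon)/2$. 3. Whenever the arguments of the respective logarithms are at least $1$, these bounds satisfy $K_u(\epsilon)\le(m+\sqrt{m\bar C})\log\big[(1+\frac{L_f}{\mu})\frac{P(x^0,x^*)}{\epsilon}\big]$ and $\tilde K(\epsilon)/2\le2(m+\sqrt{m\bar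 C})\log\big[2(\mu+2L_f+\frac{L_f^2}{\mu})(m+\sqrt{m\bar C})\frac{P(x^0,x^*)}{\epsilon}\big]$; so both are of order $(m+\sqrt{m\bar C})\log(1/\epsilon)$ up to the constants inside the logarithms. -/

import Mathlib

open MeasureTheory ProbabilityTheory Set

namespace RPDG

/-- The conjugate (Fenchel dual) `J(y) = sup_x (⟨y, x⟩ - f(x))`, meaningful on `conjDom f`. -/
noncomputable def conj {E : Type*} [NormedAddCommGroup E] [NormedSpace ℝ E]
    (f : E → ℝ) (y : E →L[ℝ] ℝ) : ℝ :=
  ⨆ x : E, (y x - f x)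

/-- The dual feasible set: the functionals at which the conjugate of `f` is finite. -/
def conjDom {E : Type*} [NormedAddCommGroup E] [NormedSpace ℝ E]
    (f : E → ℝ) : Set (E →L[ℝ] ℝ) :=
  {y | BddAbove (range fun x : E => y x - f x)}

/-- `w` is a subgradient at `x ∈ X` of the function `φ : X → ℝ` (values off `X` are ignored). -/
def IsSubgradientOn {E : Type*} [NormedAddCommGroup E] [NormedSpace ℝ E]
    (X : Set E) (φ : E → ℝ) (x : E) (w : E →L[ℝ] ℝ) : Prop :=
  x ∈ X ∧ ∀ z ∈ X, φ x + w (z - x) ≤ φ z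

/-- The set of minimizers of `φ` over `S`. -/
def argminOn {V : Type*} (S : Set V) (φ : V → ℝ) : Set V :=
  {u | u ∈ S ∧ IsMinOn φ S u}

/-- The prox-function `P(x⁰, x) = ω(x) - [ω(x⁰) + ⟨ω'(x⁰), x - x⁰⟩]`, where `w = ω'(x⁰)` is the
selected subgradient. -/
def primalProxFun {E : Type*} [NormedAddCommGroup E] [NormedSpace ℝ E]
    (ω : E → ℝ) (w : E →L[ℝ] ℝ) (x₀ x : E) : ℝ :=
  ω x - (ω x₀ + w (x - x₀))

/-- The dual prox-function `D(y⁰, y) = J(y) - [J(y⁰) + ⟨J'(y⁰), y - y⁰⟩]`, where `J` is the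
conjugate of `f` and `u = J'(y⁰)` is the selected subgradient, a point of the primal space. -/
noncomputable def dualProxFun {E : Type*} [NormedAddCommGroup E] [NormedSpace ℝ E]
    (f : E → ℝ) (u : E) (y₀ y : E →L[ℝ] ℝ) : ℝ :=
  conj f y - (conj f y₀ + (y - y₀) u)

/-- The dual prox-mapping: minimizers over `y` of `⟨-x̃, y⟩ + J(y) + τ D(y⁰, y)`. -/
noncomputable def dualProxMap {E : Type*} [NormedAddCommGroup E] [NormedSpace ℝ E]
    (f : E → ℝ) (xt : E) (u : E) (y₀ : E →L[ℝ] ℝ) (τ : ℝ) : Set (E →L[ℝ] ℝ) :=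
  argminOn (conjDom f) fun y => -(y xt) + conj f y + τ * dualProxFun f u y₀ y

/-- The problem `min_{x ∈ X} ∑ i, f i x + h x + μ ω x` on a finite-dimensional space with an
arbitrary norm, with its standing assumptions. Gradients are elements of the dual space with the
dual norm. -/
structure Problem (m : ℕ) (E : Type*) [NormedAddCommGroup E] [NormedSpace ℝ E] where
  X : Set E
  f : Fin m → E → ℝ
  h : E → ℝ
  ω : E → ℝ
  μ : ℝ
  L : Fin m → ℝ
  Lf : ℝ
  isClosed_X : IsClosed X
  convex_X : Convex ℝ X
  convex_f : ∀ i, ConvexOn ℝ univ (f i)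
  differentiable_f : ∀ i, Differentiable ℝ (f i)
  L_nonneg : ∀ i, 0 ≤ L i
  lipschitz_f : ∀ i x z, ‖fderiv ℝ (f i) x - fderiv ℝ (f i) z‖ ≤ L i * ‖x - z‖
  Lf_nonneg : 0 ≤ Lf
  /-- `Lf` is a Lipschitz constant of the gradient of `∑ i, f i`. -/
  lipschitz_sum : ∀ x z, ‖fderiv ℝ (fun v => ∑ i, f i v) x -
    fderiv ℝ (fun v => ∑ i, f i v) z‖ ≤ Lf * ‖x - z‖
  convex_h : ConvexOn ℝ X h
  /-- `ω` is strongly convex on `X` with modulus `1` for the norm of `E`. -/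
  strongConvex_ω : StrongConvexOn X 1 ω
  μ_pos : 0 < μ

/-- The objective function. -/
def Problem.Psi {m : ℕ} {E : Type*} [NormedAddCommGroup E] [NormedSpace ℝ E]
    (Q : Problem m E) (x : E) : ℝ :=
  ∑ i, Q.f i x + Q.h x + Q.μ * Q.ω x

/-- The primal prox-mapping: minimizers over `x ∈ X` of
`⟨g, x⟩ + h(x) + μ ω(x) + η P(x⁰, x)`, where `w = ω'(x⁰)`. -/
def Problem.primalProxMap {m : ℕ} {E : Type*} [NormedAddCommGroup E] [NormedSpace ℝ E]
    (Q : Problem m E) (g : E →L[ℝ] ℝ) (w : E →L[ℝ] ℝ) (x₀ : E) (η : ℝ) : Set E :=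
  argminOn Q.X fun x => g x + Q.h x + Q.μ * Q.ω x + η * primalProxFun Q.ω w x₀ x

/-- The rule by which the subgradient `w₁ = ω'(x₁)` is selected at the new point `x₁`: it takes
part in the optimality condition of the prox-mapping, that is, for some `v ∈ ∂h(x₁)` the functional
`g + v + (μ + η) w₁ - η w` is nonnegative on `X - x₁`. -/
def Problem.IsSelection {m : ℕ} {E : Type*} [NormedAddCommGroup E] [NormedSpace ℝ E]
    (Q : Problem m E) (g : E →L[ℝ] ℝ) (w : E →L[ℝ] ℝ) (η : ℝ) (x₁ : E)
    (w₁ : E →L[ℝ] ℝ) : Prop :=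
  IsSubgradientOn Q.X Q.ω x₁ w₁ ∧
    ∃ v : E →L[ℝ] ℝ, IsSubgradientOn Q.X Q.h x₁ v ∧
      ∀ x ∈ Q.X, 0 ≤ (g + v + (Q.μ + η) • w₁ - η • w) (x - x₁)

/-- What the method keeps after iteration `t`: the points `x^t` and `x^{t-1}`, the selected
subgradient `ω'(x^t)`, the dual variables `y_i^t` and the selected subgradients
`u_i^t = J_i'(y_i^t)`. -/
structure State (m : ℕ) (E : Type*) [NormedAddCommGroup E] [NormedSpace ℝ E] where
  x : E
  xprev : E
  w : E →L[ℝ] ℝ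
  y : Fin m → (E →L[ℝ] ℝ)
  u : Fin m → E

/-- The primal prediction `x̃^t = α (x^{t-1} - x^{t-2}) + x^{t-1}`. -/
def State.xtilde {m : ℕ} {E : Type*} [NormedAddCommGroup E] [NormedSpace ℝ E]
    (s : State m E) (α : ℝ) : E :=
  α • (s.x - s.xprev) + s.x

/-- The dual prediction `ỹ^t` from `y = y^{t-1}` and `y' = y^t` when index `i` was drawn. -/
noncomputable def dualPrediction {m : ℕ} {E : Type*} [NormedAddCommGroup E] [NormedSpace ℝ E]
    (p : Fin m → ℝ) (i : Fin m) (y y' : Fin m → (E →L[ℝ] ℝ)) (j : Fin m) : E →L[ℝ] ℝ :=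
  if j = i then (p j)⁻¹ • (y' j - y j) + y j else y j

/-- One iteration of the method from `s` to `s'`, with index `i` drawn. -/
structure IsStep {m : ℕ} {E : Type*} [NormedAddCommGroup E] [NormedSpace ℝ E]
    (Q : Problem m E) (p : Fin m → ℝ) (τ η α : ℝ) (i : Fin m) (s s' : State m E) : Prop where
  xprev_eq : s'.xprev = s.x
  y_drawn : s'.y i ∈ dualProxMap (Q.f i) (s.xtilde α) (s.u i) (s.y i) τ
  y_other : ∀ j, j ≠ i → s'.y j = s.y j
  u_drawn : s'.u i = (1 + τ)⁻¹ • (s.xtilde α + τ • s.u i)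
  u_other : ∀ j, j ≠ i → s'.u j = s.u j
  x_mem : s'.x ∈ Q.primalProxMap (∑ j, dualPrediction p i s.y s'.y j) s.w s.x η
  w_sel : Q.IsSelection (∑ j, dualPrediction p i s.y s'.y j) s.w η s'.x s'.w

/-- A run of the method with probabilities `p` and parameter sequences `τ_t, η_t, α_t`: the state
`R l` after the indices in the list `l` (most recent first) have been drawn. So the iterates and the
selected subgradients may depend on the past draws only. -/
structure IsRun {m : ℕ} {E : Type*} [NormedAddCommGroup E] [NormedSpace ℝ E]
    (Q : Problem m E) (p : Fin m → ℝ) (τ η α : ℕ → ℝ) (x₀ : E) (w₀ : E →L[ℝ] ℝ)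
    (R : List (Fin m) → State m E) : Prop where
  w₀_mem : IsSubgradientOn Q.X Q.ω x₀ w₀
  init : R [] = { x := x₀, xprev := x₀, w := w₀, y := fun i => fderiv ℝ (Q.f i) x₀,
                  u := fun _ => x₀ }
  step : ∀ (l : List (Fin m)) (i : Fin m),
    IsStep Q p (τ (l.length + 1)) (η (l.length + 1)) (α (l.length + 1)) i (R l) (R (i :: l))

/-- The indices drawn in the first `k` iterations, most recent first; `I t` is the index drawn in
iteration `t + 1`. -/
def history {m : ℕ} {Ω : Type*} (I : ℕ → Ω → Fin m) : ℕ → Ω → List (Fin m)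
  | 0, _ => []
  | k + 1, a => I k a :: history I k a

/-- The random iterate `x^k`. -/
def iterate {m : ℕ} {E : Type*} [NormedAddCommGroup E] [NormedSpace ℝ E] {Ω : Type*}
    (R : List (Fin m) → State m E) (I : ℕ → Ω → Fin m) (k : ℕ) (a : Ω) : E :=
  (R (history I k a)).x

/-- The random value `P(x^k, z)`, formed with the selected subgradient `ω'(x^k)`. -/
def proxDist {m : ℕ} {E : Type*} [NormedAddCommGroup E] [NormedSpace ℝ E] {Ω : Type*}
    (Q : Problem m E) (R : List (Fin m) → State m E) (I : ℕ → Ω → Fin m) (z : E) (k : ℕ)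
    (a : Ω) : ℝ :=
  primalProxFun Q.ω (R (history I k a)).w (iterate R I k a) z

/-- The ergodic mean `(∑_{t=1}^k θ_t)⁻¹ ∑_{t=1}^k θ_t x^t` with `θ_t = α^{-t}`. -/
noncomputable def ergodicMean {m : ℕ} {E : Type*} [NormedAddCommGroup E] [NormedSpace ℝ E]
    {Ω : Type*} (R : List (Fin m) → State m E) (I : ℕ → Ω → Fin m) (α : ℝ) (k : ℕ) (a : Ω) : E :=
  (∑ t ∈ Finset.Icc 1 k, (α ^ t)⁻¹)⁻¹ • ∑ t ∈ Finset.Icc 1 k, (α ^ t)⁻¹ • iterate R I t a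

/-- `K_u(ε, C)`, where `P₀` stands for `P(x⁰, x*)`. -/
noncomputable def Ku (m : ℕ) (μ Lf P₀ ε C : ℝ) : ℝ :=
  ((m + 1) + √((m - 1) ^ 2 + 4 * m * C)) / 2 * Real.log ((1 + Lf / μ) * (P₀ / ε))

/-- `K̃(ε, C)`, where `P₀` stands for `P(x⁰, x*)`. -/
noncomputable def Ktilde (m : ℕ) (μ Lf P₀ ε C : ℝ) : ℝ :=
  2 * ((m + 1) + √((m - 1) ^ 2 + 4 * m * C)) *
    Real.log (2 * (μ + 2 * Lf + Lf ^ 2 / μ) * (m + √(m * C)) * (P₀ / ε))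

end RPDG

/-! ### Convex analysis: Bregman distances, cocoercivity, and the dual prox-mapping as a gradient.
-/

namespace RPDG

variable {E : Type*} [NormedAddCommGroup E] [NormedSpace ℝ E]

/-! Conjugates are eliminated first. By Fenchel–Young, `eq_fderiv_of_mem_dualProxMap` turns each
dual iterate into the gradient of `f i` at the primal point `u i`, and the dual prox-distance to
`∇f_i(x*)` becomes `bregman (f i) (u i) x*`. What remains is a randomized gradient method, measured
by `potential`: prox-distance and Bregman distances to the optimum, plus a correction that carries
the extrapolation term from one step to the next.

For each drawn index, `potential_step` adds the three-point inequalities of the primal and the dual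
step. The change `δ` of the drawn gradient also meets two successive displacements of `x`; these
products are absorbed by cocoercivity (`sq_norm_fderiv_sub_le`) and Young's inequality (`cross_le`),
which is why `4 m L_i ≤ η τ` is needed. The other leftover terms average to zero over the index, so
the mean of `linGap + potential` after a step is at most `α` times the old potential.

Since `linGap ≥ 0` on `X` by optimality and the potential dominates `(μ + η) P`, the prox-distance
decays like `α ^ k`. Summing the recursion with weights `α ^ (-t)` also controls the averaged
`linGap`; the objective gap exceeds `linGap` by at most a squared distance, which the first rate
controls. Markov's inequality gives the probability bounds. -/

theorem nonneg_of_forall_add_mul {a b : ℝ} (H : ∀ t : ℝ, 0 < t → t ≤ 1 → 0 ≤ a + b * t) :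
    0 ≤ a := by
  by_contra! ha
  have hb : 0 < 1 + |b| := by positivity
  have hb' := le_abs_self b
  set t := min 1 (-a / (2 * (1 + |b|))) with ht
  have ht0 : 0 < t := lt_min one_pos (div_pos (by linarith) (by linarith))
  have h1 := H t ht0 (min_le_left _ _)
  have h2 : t * (2 * (1 + |b|)) ≤ -a := by
    rw [← le_div_iff₀ (by linarith)]; exact min_le_right _ _
  nlinarith [mul_le_mul_of_nonneg_right hb' ht0.le]

/-- The quadratic upper bound for functions with a Lipschitz continuous gradient. -/
theorem le_add_fderiv_add_sq {f : E → ℝ} {L : ℝ} (hf : Differentiable ℝ f)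
    (hL : ∀ x z, ‖fderiv ℝ f x - fderiv ℝ f z‖ ≤ L * ‖x - z‖) (x v : E) :
    f (x + v) ≤ f x + fderiv ℝ f x v + L / 2 * ‖v‖ ^ 2 := by
  let φ : ℝ → ℝ := fun t => f (x + t • v) - t * fderiv ℝ f x v - L / 2 * ‖v‖ ^ 2 * t ^ 2
  have hd : ∀ t : ℝ, HasDerivAt φ
      (fderiv ℝ f (x + t • v) v - fderiv ℝ f x v - L / 2 * ‖v‖ ^ 2 * (2 * t)) t := by
    intro t
    have h1 : HasDerivAt (fun t : ℝ => x + t • v) v t := by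
      simpa using ((hasDerivAt_id t).smul_const v).const_add x
    have h2 := (hf (x + t • v)).hasFDerivAt.comp_hasDerivAt t h1
    have h3 := (hasDerivAt_id t).mul_const (fderiv ℝ f x v)
    have h4 := (hasDerivAt_pow 2 t).const_mul (L / 2 * ‖v‖ ^ 2)
    refine ((h2.sub h3).sub h4).congr_deriv ?_
    simp
  have hanti : AntitoneOn φ (Icc 0 1) := by
    refine antitoneOn_of_deriv_nonpos (convex_Icc 0 1)
      (fun t _ => (hd t).continuousAt.continuousWithinAt)
      (fun t _ => (hd t).differentiableAt.differentiableWithinAt) ?_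
    intro t ht
    rw [interior_Icc] at ht
    rw [(hd t).deriv]
    have h1 := (fderiv ℝ f (x + t • v) - fderiv ℝ f x).le_opNorm v
    have h2 := hL (x + t • v) x
    rw [add_sub_cancel_left, norm_smul, Real.norm_of_nonneg ht.1.le] at h2
    have h3 := (le_abs_self _).trans (h1.trans (mul_le_mul_of_nonneg_right h2 (norm_nonneg v)))
    rw [sub_apply] at h3
    nlinarith
  have h := hanti (left_mem_Icc.2 zero_le_one) (right_mem_Icc.2 zero_le_one) zero_le_one
  simp only [φ, one_smul, zero_smul, add_zero, one_mul, zero_mul] at h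
  linarith

theorem add_fderiv_le_of_convexOn {f : E → ℝ} (hc : ConvexOn ℝ univ f) (hf : Differentiable ℝ f)
    (x z : E) : f z + fderiv ℝ f z (x - z) ≤ f x := by
  have hc' : ConvexOn ℝ univ (fun t : ℝ => f (z + t • (x - z))) := by
    have := hc.comp_affineMap (AffineMap.lineMap z x : ℝ →ᵃ[ℝ] E)
    simpa [Function.comp_def, AffineMap.lineMap_apply, add_comm] using this
  have hd : HasDerivAt (fun t : ℝ => f (z + t • (x - z))) (fderiv ℝ f z (x - z)) 0 := by
    have h1 : HasDerivAt (fun t : ℝ => z + t • (x - z)) (x - z) 0 := by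
      simpa using ((hasDerivAt_id (0 : ℝ)).smul_const (x - z)).const_add z
    have h2 := HasFDerivAt.comp_hasDerivAt (f := fun t : ℝ => z + t • (x - z)) 0
      (hf (z + (0 : ℝ) • (x - z))).hasFDerivAt h1
    simpa [Function.comp_def] using h2
  have := hc'.le_slope_of_hasDerivAt (mem_univ _) (mem_univ _) zero_lt_one hd
  simp only [slope_def_field, one_smul, zero_smul, add_zero, sub_zero, div_one,
    add_sub_cancel] at this
  linarith

/-- The Bregman distance of `f` between `a` and `b`, with the gradient taken at `b`. -/
noncomputable def bregman (f : E → ℝ) (a b : E) : ℝ := f a - f b - fderiv ℝ f b (a - b)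

theorem bregman_nonneg {f : E → ℝ} (hc : ConvexOn ℝ univ f) (hf : Differentiable ℝ f)
    (a b : E) : 0 ≤ bregman f a b := by
  have := add_fderiv_le_of_convexOn hc hf a b
  unfold bregman; linarith

/-- Cocoercivity in an arbitrary norm. At `u - r • v`, the quadratic upper bound from `u` lies above
the tangent at `z`; so a quadratic in `r` is nonnegative everywhere, and its discriminant bounds the
gradient difference along `v`. The case `L = 0` needs no separate treatment. -/
theorem sq_norm_fderiv_sub_le {f : E → ℝ} {L : ℝ} (hc : ConvexOn ℝ univ f)
    (hf : Differentiable ℝ f) (hL0 : 0 ≤ L)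
    (hL : ∀ x z, ‖fderiv ℝ f x - fderiv ℝ f z‖ ≤ L * ‖x - z‖) (u z : E) :
    ‖fderiv ℝ f u - fderiv ℝ f z‖ ^ 2 ≤ 2 * L * bregman f u z := by
  have hB := bregman_nonneg hc hf u z
  have hLB : 0 ≤ 2 * L * bregman f u z := by positivity
  have key : ∀ v, ‖(fderiv ℝ f u - fderiv ℝ f z) v‖ ≤ √(2 * L * bregman f u z) * ‖v‖ := by
    intro v
    have h := discrim_le_zero (a := L / 2 * ‖v‖ ^ 2)
      (b := -((fderiv ℝ f u - fderiv ℝ f z) v)) (c := bregman f u z) (by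
        intro r
        have h1 := le_add_fderiv_add_sq hf hL u (-(r • v))
        have h2 := add_fderiv_le_of_convexOn hc hf (u + -(r • v)) z
        rw [norm_neg, norm_smul, mul_pow, Real.norm_eq_abs, sq_abs] at h1
        have h3 : u + -(r • v) - z = (u - z) - r • v := by abel
        rw [h3, map_sub, map_smul, smul_eq_mul] at h2
        rw [map_neg, map_smul, smul_eq_mul] at h1
        simp only [bregman, sub_apply]
        nlinarith)
    rw [discrim] at h
    refine abs_le_of_sq_le_sq ?_ (by positivity)
    rw [mul_pow, Real.sq_sqrt hLB]
    linarith
  have h := ContinuousLinearMap.opNorm_le_bound _ (Real.sqrt_nonneg _) key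
  calc _ ≤ (√(2 * L * bregman f u z)) ^ 2 := by gcongr
    _ = _ := Real.sq_sqrt hLB

/-- Compare the subgradient inequality with strong convexity at a point of the segment from `x` to
`z`, divide by `t` and let `t → 0`. -/
theorem half_sq_norm_le_primalProxFun {X : Set E} {ω : E → ℝ} (hω : StrongConvexOn X 1 ω) {x z : E}
    {w : E →L[ℝ] ℝ} (hw : IsSubgradientOn X ω x w) (hz : z ∈ X) :
    1 / 2 * ‖z - x‖ ^ 2 ≤ primalProxFun ω w x z := by
  suffices 0 ≤ primalProxFun ω w x z - 1 / 2 * ‖z - x‖ ^ 2 by linarith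
  refine nonneg_of_forall_add_mul (b := 1 / 2 * ‖z - x‖ ^ 2) fun t ht ht1 => ?_
  have h1 := hω.2 hw.1 hz (sub_nonneg.2 ht1) ht.le (sub_add_cancel 1 t)
  have hmem := hω.1 hw.1 hz (sub_nonneg.2 ht1) ht.le (sub_add_cancel 1 t)
  have h2 := hw.2 _ hmem
  have h3 : (1 - t) • x + t • z - x = t • (z - x) := by module
  rw [h3, map_smul, smul_eq_mul] at h2
  rw [norm_sub_rev] at h1
  simp only [smul_eq_mul] at h1
  unfold primalProxFun
  have : 0 ≤ t * (ω z - (ω x + w (z - x)) - 1 / 2 * ‖z - x‖ ^ 2 + 1 / 2 * ‖z - x‖ ^ 2 * t) := by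
    nlinarith
  exact nonneg_of_mul_nonneg_right this ht

theorem conj_fderiv {f : E → ℝ} (hc : ConvexOn ℝ univ f) (hf : Differentiable ℝ f) (u : E) :
    fderiv ℝ f u ∈ conjDom f ∧ conj f (fderiv ℝ f u) = fderiv ℝ f u u - f u := by
  have hle : ∀ x, fderiv ℝ f u x - f x ≤ fderiv ℝ f u u - f u := fun x => by
    have := add_fderiv_le_of_convexOn hc hf x u
    rw [map_sub] at this; linarith
  have hb : BddAbove (range fun x : E => fderiv ℝ f u x - f x) :=
    ⟨_, by rintro _ ⟨x, rfl⟩; exact hle x⟩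
  exact ⟨hb, le_antisymm (ciSup_le hle) (le_ciSup hb u)⟩

/-- The dual prox-mapping is the evaluation of a gradient at an averaged point. -/
theorem eq_fderiv_of_mem_dualProxMap {f : E → ℝ} (hc : ConvexOn ℝ univ f)
    (hf : Differentiable ℝ f) {xt u : E} {y₀ y : E →L[ℝ] ℝ} {τ : ℝ} (hτ : 0 ≤ τ)
    (hy : y ∈ dualProxMap f xt u y₀ τ) :
    y = fderiv ℝ f ((1 + τ)⁻¹ • (xt + τ • u)) := by
  set c := (1 + τ)⁻¹ • (xt + τ • u) with hcdef
  have hτ1 : 0 < 1 + τ := by linarith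
  have hc1 : xt = (1 + τ) • c - τ • u := by
    rw [hcdef, smul_inv_smul₀ hτ1.ne']; abel
  obtain ⟨hdom, hmin⟩ := hy
  obtain ⟨hgdom, hg⟩ := conj_fderiv hc hf c
  have h := hmin hgdom
  simp only [mem_ofPred_eq, dualProxFun, hg, hc1, map_sub, map_smul, smul_eq_mul,
    sub_apply] at h
  -- In terms of `c` the prox objective is `(1 + τ) * (conj f y - y c)` plus a constant, and the
  -- competitor `∇f(c)` attains equality in Fenchel–Young. Hence `y` does too, so `c` maximizes `y x
  -- - f x` and Fermat's rule applies.
  have h1 : conj f y ≤ y c - f c := by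
    have : (1 + τ) * conj f y ≤ (1 + τ) * (y c - f c) := by linarith
    exact le_of_mul_le_mul_left this hτ1
  have h2 : ∀ x, y x - f x ≤ y c - f c := fun x => (le_ciSup hdom x).trans h1
  have hloc : IsLocalMin (fun x => f x - y x) c :=
    Filter.Eventually.of_forall fun x => by have := h2 x; simp only; linarith
  have hd : HasFDerivAt (fun x => f x - y x) (fderiv ℝ f c - y) c :=
    (hf c).hasFDerivAt.sub y.hasFDerivAt
  exact (sub_eq_zero.1 (hloc.hasFDerivAt_eq_zero hd)).symm

end RPDG

/-! ### The Lyapunov function and its one-step decrease. -/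

namespace RPDG

variable {E : Type*} [NormedAddCommGroup E] [NormedSpace ℝ E]

theorem sum_eq_sum_add_of_eq_off {ι M : Type*} [Fintype ι] [DecidableEq ι] [AddCommGroup M]
    {a b : ι → M} (i : ι) (hab : ∀ j, j ≠ i → b j = a j) :
    ∑ j, b j = ∑ j, a j + (b i - a i) := by
  rw [← sub_eq_iff_eq_add', ← Finset.sum_sub_distrib]
  exact Finset.sum_eq_single i (fun j _ hj => by rw [hab j hj, sub_self]) (by simp)

variable {m : ℕ} (Q : Problem m E) (xs : E)

/-- The gap `φ(x) - φ(x*) + ⟨∑ᵢ ∇fᵢ(x*), x - x*⟩` with `φ = h + μ ω`. -/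
noncomputable def Problem.linGap (x : E) : ℝ :=
  Q.h x + Q.μ * Q.ω x - (Q.h xs + Q.μ * Q.ω xs) + ∑ i, fderiv ℝ (Q.f i) xs (x - xs)

/-- The deviation `∑ᵢ (yᵢ - ∇fᵢ(x*))` of the aggregated dual variable. -/
noncomputable def Problem.dualDev (s : State m E) : E →L[ℝ] ℝ :=
  ∑ i, (s.y i - fderiv ℝ (Q.f i) xs)

/-- The Lyapunov function of the method. -/
noncomputable def Problem.potential (τ η : ℝ) (s : State m E) : ℝ :=
  (Q.μ + η) * primalProxFun Q.ω s.w s.x xs + (1 + τ) * m * ∑ i, bregman (Q.f i) (s.u i) xs +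
    Q.dualDev xs s (s.x - s.xprev) + η / 4 * ‖s.x - s.xprev‖ ^ 2

/-- The properties shared by all states of a run. -/
structure Problem.IsAdmissible (s : State m E) : Prop where
  subgrad : IsSubgradientOn Q.X Q.ω s.x s.w
  y_eq : ∀ i, s.y i = fderiv ℝ (Q.f i) (s.u i)

/-- The relations between the parameters that the convergence proof uses. -/
structure Problem.IsParam (τ η α : ℝ) : Prop where
  m_pos : 0 < m
  τ_nonneg : 0 ≤ τ
  η_pos : 0 < η
  α_pos : 0 < α
  α_lt_one : α < 1
  η_eq : η = α * (Q.μ + η)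
  τ_eq : (1 + τ) * m - 1 = α * ((1 + τ) * m)
  μ_eq : Q.μ * ((1 + τ) * m) = Q.μ + η
  L_le : ∀ i, 4 * m * Q.L i ≤ η * τ

variable {Q xs} {τ η α : ℝ} {i : Fin m} {s s' : State m E}

theorem Problem.IsAdmissible.of_isStep (hτ : 0 ≤ τ) (hs : Q.IsAdmissible s) {p : Fin m → ℝ}
    (h : IsStep Q p τ η α i s s') : Q.IsAdmissible s' where
  subgrad := h.w_sel.1
  y_eq j := by
    rcases eq_or_ne j i with rfl | hj
    · rw [h.u_drawn]
      exact eq_fderiv_of_mem_dualProxMap (Q.convex_f j) (Q.differentiable_f j) hτ h.y_drawn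
    · rw [h.y_other j hj, h.u_other j hj, hs.y_eq j]

/-- The two sides differ by exactly `bregman f xs c`, which is nonnegative. -/
theorem bregman_three_point {f : E → ℝ} (hc : ConvexOn ℝ univ f) (hf : Differentiable ℝ f)
    (hτ : 0 ≤ τ) (xt u : E) {c : E} (hcdef : c = (1 + τ)⁻¹ • (xt + τ • u)) :
    (1 + τ) * bregman f c xs + τ * bregman f u c - τ * bregman f u xs ≤
      (fderiv ℝ f c - fderiv ℝ f xs) (xt - xs) := by
  have hτ1 : 0 < 1 + τ := by linarith
  have hc1 : xt = (1 + τ) • c - τ • u := by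
    rw [hcdef, smul_inv_smul₀ hτ1.ne']; abel
  have h := add_fderiv_le_of_convexOn hc hf xs c
  simp only [bregman, hc1, map_sub, map_smul, smul_eq_mul, sub_apply] at h ⊢
  linarith

/-- Young's inequality from the square of `2 * M * e - η * n`. It is applied with `e` the norm of a
gradient difference and `d` the Bregman distance bounding it by cocoercivity. -/
theorem cross_le {M d e n : ℝ} (hM : 0 ≤ M) (hη : 0 < η) (he : 2 * M * e ^ 2 ≤ η * τ * d) :
    M * (e * n) ≤ M * τ * d / 2 + η / 4 * n ^ 2 := by
  have h1 : 0 ≤ (2 * M * e - η * n) ^ 2 := sq_nonneg _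
  have h2 := mul_le_mul_of_nonneg_left he hM
  have : η * (M * (e * n)) ≤ η * (M * τ * d / 2 + η / 4 * n ^ 2) := by nlinarith
  exact le_of_mul_le_mul_left this hη

/-- The primal step: the three-point inequality of the prox-mapping. -/
theorem primal_step {g w w' : E →L[ℝ] ℝ} {x x' : E} (hη : 0 < η) (hxs : xs ∈ Q.X)
    (hw : IsSubgradientOn Q.X Q.ω x w) (h : Q.IsSelection g w η x' w') :
    Q.h x' + Q.μ * Q.ω x' - (Q.h xs + Q.μ * Q.ω xs) + g (x' - xs) ≤
      η * primalProxFun Q.ω w x xs - (Q.μ + η) * primalProxFun Q.ω w' x' xs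
        - η / 2 * ‖x' - x‖ ^ 2 := by
  obtain ⟨hw', v, hv, hsel⟩ := h
  have h1 := hsel xs hxs
  have h2 := hv.2 xs hxs
  have h3 := mul_le_mul_of_nonneg_left
    (half_sq_norm_le_primalProxFun Q.strongConvex_ω hw hw'.1) hη.le
  simp only [primalProxFun, add_apply, sub_apply, smul_apply, map_sub,
    smul_eq_mul] at h1 h2 h3 ⊢
  linarith

/-- The inequality holds for every drawn index; the two bracketed terms on the right vanish when
averaged over `i`. -/
theorem potential_step (hQ : Q.IsParam τ η α) (hxs : xs ∈ Q.X) (hs : Q.IsAdmissible s)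
    (h : IsStep Q (fun _ => 1 / (m : ℝ)) τ η α i s s') :
    Q.linGap xs s'.x + Q.potential xs τ η s' ≤ α * Q.potential xs τ η s +
      (m * (s.y i - fderiv ℝ (Q.f i) xs) (s.xtilde α - xs) - Q.dualDev xs s (s.xtilde α - xs)) +
      (∑ j, bregman (Q.f j) (s.u j) xs - m * bregman (Q.f i) (s.u i) xs) := by
  have hs' := hs.of_isStep hQ.τ_nonneg h
  set δ := s'.y i - s.y i with hδ
  set Δ := s.x - s.xprev with hΔ
  set Δ' := s'.x - s.x with hΔ'
  set D := Q.dualDev xs s with hD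
  have hm : (1 : ℝ) ≤ m := by exact_mod_cast hQ.m_pos
  have hD' : Q.dualDev xs s' = D + δ := by
    have := sum_eq_sum_add_of_eq_off (a := fun j => s.y j - fderiv ℝ (Q.f j) xs)
      (b := fun j => s'.y j - fderiv ℝ (Q.f j) xs) i (fun j hj => by simp only [h.y_other j hj])
    rw [Problem.dualDev, this, hD, Problem.dualDev, hδ]; congr 1; abel
  have hB' : ∑ j, bregman (Q.f j) (s'.u j) xs = ∑ j, bregman (Q.f j) (s.u j) xs +
      (bregman (Q.f i) (s'.u i) xs - bregman (Q.f i) (s.u i) xs) :=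
    sum_eq_sum_add_of_eq_off i (fun j hj => by rw [h.u_other j hj])
  have hg : ∑ j, dualPrediction (fun _ => 1 / (m : ℝ)) i s.y s'.y j =
      ∑ j, fderiv ℝ (Q.f j) xs + D + (m : ℝ) • δ := by
    rw [sum_eq_sum_add_of_eq_off (a := s.y) i (fun j hj => by simp [dualPrediction, hj])]
    simp only [dualPrediction, if_true, one_div, inv_inv, hD, Problem.dualDev,
      Finset.sum_sub_distrib, hδ]
    abel
  have hprim := primal_step hQ.η_pos hxs hs.subgrad h.w_sel
  rw [hg] at hprim
  have hdual := bregman_three_point (xs := xs) (Q.convex_f i) (Q.differentiable_f i) hQ.τ_nonneg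
    (s.xtilde α) (s.u i) h.u_drawn
  rw [← hs'.y_eq i] at hdual
  have hco : ‖δ‖ ^ 2 ≤ 2 * Q.L i * bregman (Q.f i) (s.u i) (s'.u i) := by
    rw [hδ, hs'.y_eq i, hs.y_eq i, norm_sub_rev]
    exact sq_norm_fderiv_sub_le (Q.convex_f i) (Q.differentiable_f i) (Q.L_nonneg i)
      (Q.lipschitz_f i) _ _
  set d := bregman (Q.f i) (s.u i) (s'.u i) with hd
  have hd0 : 0 ≤ d := bregman_nonneg (Q.convex_f i) (Q.differentiable_f i) _ _
  have he : 2 * m * ‖δ‖ ^ 2 ≤ η * τ * d := by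
    nlinarith [mul_le_mul_of_nonneg_right (hQ.L_le i) hd0]
  have hc1 := cross_le (n := ‖Δ‖) (by linarith : (0 : ℝ) ≤ m) hQ.η_pos he
  have hc2 := cross_le (n := ‖Δ'‖) (by linarith : (0 : ℝ) ≤ m) hQ.η_pos he
  have ha : |δ Δ'| ≤ ‖δ‖ * ‖Δ'‖ := δ.le_opNorm Δ'
  have hb : |δ Δ| ≤ ‖δ‖ * ‖Δ‖ := δ.le_opNorm Δ
  -- The dual step supplies `m * τ * d`, half for each cross term. Of the primal `η / 2 * ‖Δ'‖ ^ 2`,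
  -- half is spent here and half enters the new potential; the old potential pays for the cross term
  -- with `Δ`.
  have ha1 : -(m * τ * d / 2 + η / 4 * ‖Δ'‖ ^ 2) ≤ (m - 1) * δ Δ' := by
    have h1 := neg_le_of_abs_le ha
    have h2 := mul_le_mul_of_nonneg_left h1 (by linarith : (0 : ℝ) ≤ m - 1)
    nlinarith [mul_nonneg (norm_nonneg δ) (norm_nonneg Δ')]
  have hb1 : α * m * δ Δ ≤ m * τ * d / 2 + α * (η / 4 * ‖Δ‖ ^ 2) := by
    have h1 := mul_le_mul_of_nonneg_left (le_of_abs_le hb) (by linarith : (0 : ℝ) ≤ m)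
    have h2 := mul_le_mul_of_nonneg_left (h1.trans hc1) hQ.α_pos.le
    have h3 : 0 ≤ m * τ * d / 2 := by have := hQ.τ_nonneg; positivity
    nlinarith [hQ.α_lt_one, hQ.α_pos]
  -- The extrapolation enters here: `D` against `Δ' - α • Δ` telescopes between the potentials,
  -- leaving `x̃ - x*`, which does not depend on `i`.
  have hx : s'.x - xs = (Δ' - α • Δ) + (s.xtilde α - xs) := by
    rw [hΔ, hΔ', State.xtilde]; abel
  have hsplit : (D + (m : ℝ) • δ) (s'.x - xs) = (D + δ) Δ' + (m - 1) * δ Δ' - α * D Δ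
      - α * m * δ Δ + D (s.xtilde α - xs) + m * δ (s.xtilde α - xs) := by
    rw [hx]
    simp only [map_add, map_sub, map_smul, add_apply, smul_apply, smul_eq_mul]
    ring
  have hδt : δ (s.xtilde α - xs) = (s'.y i - fderiv ℝ (Q.f i) xs) (s.xtilde α - xs) -
      (s.y i - fderiv ℝ (Q.f i) xs) (s.xtilde α - xs) := by
    simp only [hδ, sub_apply]; ring
  have hdual' := mul_le_mul_of_nonneg_left hdual (by linarith : (0 : ℝ) ≤ m)
  rw [add_assoc, add_apply, hsplit, hδt] at hprim
  simp only [Problem.linGap, Problem.potential, hD', hB', h.xprev_eq, ← hΔ', ← hΔ, ← hD]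
  rw [sum_apply] at hprim
  have e1 := congrArg (· * primalProxFun Q.ω s.w s.x xs) hQ.η_eq
  have e2 := congrArg (· * ∑ j, bregman (Q.f j) (s.u j) xs) hQ.τ_eq
  linarith

/-- One step of the method decreases the averaged potential by the factor `α`. -/
theorem sum_potential_step (hQ : Q.IsParam τ η α) (hxs : xs ∈ Q.X) (hs : Q.IsAdmissible s)
    {t : Fin m → State m E}
    (h : ∀ i, IsStep Q (fun _ => 1 / (m : ℝ)) τ η α i s (t i)) :
    1 / (m : ℝ) * ∑ i, (Q.linGap xs (t i).x + Q.potential xs τ η (t i)) ≤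
      α * Q.potential xs τ η s := by
  have hm : (0 : ℝ) < m := by exact_mod_cast hQ.m_pos
  have h1 := Finset.sum_le_sum fun i (_ : i ∈ Finset.univ) => potential_step hQ hxs hs (h i)
  have h2 : ∑ i, (s.y i - fderiv ℝ (Q.f i) xs) (s.xtilde α - xs) =
      Q.dualDev xs s (s.xtilde α - xs) := by
    rw [Problem.dualDev, sum_apply]
  simp only [Finset.sum_add_distrib, Finset.sum_sub_distrib, ← Finset.mul_sum, h2,
    Finset.sum_const, Finset.card_univ, Fintype.card_fin, nsmul_eq_mul, sub_self, add_zero] at h1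
  rw [one_div, inv_mul_le_iff₀ hm]
  rw [Finset.sum_add_distrib]
  linarith

/-- The linear correction may be negative. Cocoercivity bounds each of its `m` summands by part of
the Bregman term and a share `1 / m` of the quadratic one. -/
theorem primalProxFun_le_potential (hQ : Q.IsParam τ η α) (hs : Q.IsAdmissible s) :
    (Q.μ + η) * primalProxFun Q.ω s.w s.x xs ≤ Q.potential xs τ η s := by
  have hm : (1 : ℝ) ≤ m := by exact_mod_cast hQ.m_pos
  have hη := hQ.η_pos
  set Δ := s.x - s.xprev with hΔ
  have key : ∀ i, -((s.y i - fderiv ℝ (Q.f i) xs) Δ) ≤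
      m * τ * bregman (Q.f i) (s.u i) xs / 2 + η / 4 * (‖Δ‖ ^ 2 / m) := by
    intro i
    have hB := bregman_nonneg (Q.convex_f i) (Q.differentiable_f i) (s.u i) xs
    have h1 := sq_norm_fderiv_sub_le (Q.convex_f i) (Q.differentiable_f i) (Q.L_nonneg i)
      (Q.lipschitz_f i) (s.u i) xs
    rw [← hs.y_eq i] at h1
    set e := ‖s.y i - fderiv ℝ (Q.f i) xs‖
    have he : 2 * m * e ^ 2 ≤ η * τ * bregman (Q.f i) (s.u i) xs := by
      nlinarith [mul_le_mul_of_nonneg_right (hQ.L_le i) hB]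
    have h2 := cross_le (n := ‖Δ‖ / m) (by linarith : (0 : ℝ) ≤ m) hη he
    have h3 := neg_le_of_abs_le ((s.y i - fderiv ℝ (Q.f i) xs).le_opNorm Δ)
    have h4 : m * (e * (‖Δ‖ / m)) = e * ‖Δ‖ := by field_simp
    have h5 : (‖Δ‖ / m) ^ 2 ≤ ‖Δ‖ ^ 2 / m := by
      rw [div_pow]
      exact div_le_div_of_nonneg_left (by positivity) (by linarith) (by nlinarith)
    rw [h4] at h2
    have h6 := mul_le_mul_of_nonneg_left h5 (by linarith : 0 ≤ η / 4)
    linarith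
  have hsum := Finset.sum_le_sum fun i (_ : i ∈ Finset.univ) => key i
  have hB0 : 0 ≤ ∑ i, bregman (Q.f i) (s.u i) xs :=
    Finset.sum_nonneg fun i _ => bregman_nonneg (Q.convex_f i) (Q.differentiable_f i) _ _
  have hdev : Q.dualDev xs s Δ = ∑ i, (s.y i - fderiv ℝ (Q.f i) xs) Δ := by
    rw [Problem.dualDev, sum_apply]
  simp only [Finset.sum_add_distrib, Finset.sum_neg_distrib, ← hdev, ← Finset.mul_sum,
    ← Finset.sum_div] at hsum
  rw [Finset.sum_const, Finset.card_univ, Fintype.card_fin, nsmul_eq_mul] at hsum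
  have h7 : (m : ℝ) * ‖Δ‖ ^ 2 / m = ‖Δ‖ ^ 2 := by field_simp
  rw [h7] at hsum
  have h9 : 0 ≤ (m * τ / 2 + m) * ∑ i, bregman (Q.f i) (s.u i) xs := by
    have := hQ.τ_nonneg; positivity
  unfold Problem.potential
  rw [← hΔ]
  linarith

end RPDG

/-! ### Optimality gap, invariants of a run, and the initial potential. -/

namespace RPDG

variable {E : Type*} [NormedAddCommGroup E] [NormedSpace ℝ E] {m : ℕ} {Q : Problem m E} {xs : E}

theorem Problem.fderiv_sum (Q : Problem m E) (x : E) :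
    fderiv ℝ (fun v => ∑ i, Q.f i v) x = ∑ i, fderiv ℝ (Q.f i) x :=
  fderiv_fun_sum fun i _ => Q.differentiable_f i x

theorem Problem.sum_f_le (Q : Problem m E) (x z : E) :
    ∑ i, Q.f i x ≤ ∑ i, Q.f i z + ∑ i, fderiv ℝ (Q.f i) z (x - z) + Q.Lf / 2 * ‖x - z‖ ^ 2 := by
  have h := le_add_fderiv_add_sq (f := fun v => ∑ i, Q.f i v)
    (Differentiable.fun_sum fun i _ => Q.differentiable_f i) Q.lipschitz_sum z (x - z)
  rwa [Q.fderiv_sum, sum_apply, add_sub_cancel] at h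

theorem Problem.sum_bregman_le (Q : Problem m E) (x z : E) :
    ∑ i, bregman (Q.f i) x z ≤ Q.Lf / 2 * ‖x - z‖ ^ 2 := by
  have := Q.sum_f_le x z
  simp only [bregman, Finset.sum_sub_distrib]
  linarith

theorem Problem.convexOn_ω (Q : Problem m E) : ConvexOn ℝ Q.X Q.ω :=
  UniformConvexOn.convexOn Q.strongConvex_ω fun r => by positivity

theorem Problem.convexOn_linGap (Q : Problem m E) (xs : E) : ConvexOn ℝ Q.X (Q.linGap xs) := by
  have h1 := Q.convex_h.add (Q.convexOn_ω.smul Q.μ_pos.le)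
  have h2 : ConvexOn ℝ Q.X (fun x => (∑ i, fderiv ℝ (Q.f i) xs) x) :=
    ((∑ i, fderiv ℝ (Q.f i) xs).toLinearMap).convexOn Q.convex_X
  have h3 := (h1.add h2).add_const
    (-(Q.h xs + Q.μ * Q.ω xs) - (∑ i, fderiv ℝ (Q.f i) xs) xs)
  refine h3.congr fun x _ => ?_
  simp only [Problem.linGap, Pi.add_apply, smul_eq_mul, map_sub, sum_apply,
    Finset.sum_sub_distrib]
  ring

/-- First-order optimality of `x*`. -/
theorem Problem.linGap_nonneg (hxs : xs ∈ Q.X) (hopt : IsMinOn Q.Psi Q.X xs) {x : E}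
    (hx : x ∈ Q.X) : 0 ≤ Q.linGap xs x := by
  refine nonneg_of_forall_add_mul (b := Q.Lf / 2 * ‖x - xs‖ ^ 2) fun t ht ht1 => ?_
  have hmem := Q.convex_X hxs hx (sub_nonneg.2 ht1) ht.le (sub_add_cancel 1 t)
  have h1 := (Q.convexOn_linGap xs).2 hxs hx (sub_nonneg.2 ht1) ht.le (sub_add_cancel 1 t)
  have h2 := hopt hmem
  have h3 := Q.sum_f_le ((1 - t) • xs + t • x) xs
  have h4 : (1 - t) • xs + t • x - xs = t • (x - xs) := by module
  rw [h4, norm_smul, mul_pow, Real.norm_of_nonneg ht.le] at h3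
  have h5 : Q.linGap xs xs = 0 := by simp [Problem.linGap]
  rw [h5, smul_zero, zero_add, smul_eq_mul] at h1
  rw [Problem.linGap, h4] at h1
  simp only [mem_ofPred_eq, Problem.Psi] at h2
  have : 0 ≤ t * (Q.linGap xs x + Q.Lf / 2 * ‖x - xs‖ ^ 2 * t) := by nlinarith
  exact nonneg_of_mul_nonneg_right this ht

theorem Problem.Psi_sub_le (Q : Problem m E) (xs x : E) :
    Q.Psi x - Q.Psi xs ≤ Q.linGap xs x + Q.Lf / 2 * ‖x - xs‖ ^ 2 := by
  have := Q.sum_f_le x xs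
  simp only [Problem.Psi, Problem.linGap]
  linarith

/-- Allows Jensen's inequality on the upper model of the objective gap, whose two parts the
recursion controls separately. -/
theorem Problem.convexOn_linGap_add_sq (Q : Problem m E) (xs : E) :
    ConvexOn ℝ Q.X fun x => Q.linGap xs x + Q.Lf / 2 * ‖x - xs‖ ^ 2 := by
  have h1 : ConvexOn ℝ Q.X fun x => ‖x - xs‖ := by
    simpa [dist_eq_norm] using convexOn_dist xs Q.convex_X
  have h2 := (h1.pow (fun x _ => norm_nonneg _) 2).smul (div_nonneg Q.Lf_nonneg zero_le_two)
  exact (Q.convexOn_linGap xs).add h2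

variable {τ η α : ℝ} {x₀ : E} {w₀ : E →L[ℝ] ℝ} {R : List (Fin m) → State m E}

theorem IsRun.isAdmissible {p : Fin m → ℝ} (hτ : 0 ≤ τ)
    (hR : IsRun Q p (fun _ => τ) (fun _ => η) (fun _ => α) x₀ w₀ R) :
    ∀ l, Q.IsAdmissible (R l)
  | [] => by rw [hR.init]; exact ⟨hR.w₀_mem, fun _ => rfl⟩
  | i :: l => (hR.isAdmissible hτ l).of_isStep hτ (hR.step l i)

/-- Since `x = xprev` initially, only the prox and Bregman terms survive; the latter sum to at most
`Lf` times the prox-distance, and `μ * ((1 + τ) * m) = μ + η` converts the factor. -/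
theorem IsRun.potential_nil_le {p : Fin m → ℝ} (hQ : Q.IsParam τ η α) (hxs : xs ∈ Q.X)
    (hR : IsRun Q p (fun _ => τ) (fun _ => η) (fun _ => α) x₀ w₀ R) :
    Q.potential xs τ η (R []) ≤
      (Q.μ + η) * ((1 + Q.Lf / Q.μ) * primalProxFun Q.ω w₀ x₀ xs) := by
  have h1 := Q.sum_bregman_le x₀ xs
  have h2 := half_sq_norm_le_primalProxFun Q.strongConvex_ω hR.w₀_mem hxs
  have hK : 0 ≤ (1 + τ) * m := by have := hQ.τ_nonneg; positivity
  have hμ := Q.μ_pos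
  have h3 : ∑ i, bregman (Q.f i) x₀ xs ≤ Q.Lf * primalProxFun Q.ω w₀ x₀ xs := by
    rw [norm_sub_rev] at h1
    nlinarith [Q.Lf_nonneg]
  have h4 := mul_le_mul_of_nonneg_left h3 hK
  have h5 : (Q.μ + η) * ((1 + Q.Lf / Q.μ) * primalProxFun Q.ω w₀ x₀ xs) =
      (Q.μ + η) * primalProxFun Q.ω w₀ x₀ xs +
        (1 + τ) * m * (Q.Lf * primalProxFun Q.ω w₀ x₀ xs) := by
    rw [← hQ.μ_eq]; field_simp
  rw [h5, hR.init]
  simp only [Problem.potential, sub_self, map_zero, norm_zero]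
  linarith

/-! ### Histories of draws and conditioning on the past. -/

section Probability

variable {Ω : Type*} {I : ℕ → Ω → Fin m}

theorem length_history (k : ℕ) (a : Ω) : (history I k a).length = k := by
  induction k with
  | zero => rfl
  | succ k ih => simp [history, ih]

theorem history_eq_drop {t k : ℕ} (htk : t ≤ k) (a : Ω) :
    history I t a = (history I k a).drop (k - t) := by
  induction k, htk using Nat.le_induction with
  | base => simp
  | succ k htk ih => rw [Nat.succ_sub htk, history, List.drop_succ_cons, ih]

variable [MeasurableSpace Ω] {Pr : Measure Ω} [IsProbabilityMeasure Pr]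

theorem measurableSet_history (hI : ∀ t, Measurable (I t)) (k : ℕ) (s : Set (List (Fin m))) :
    MeasurableSet (history I k ⁻¹' s) := by
  induction k generalizing s with
  | zero => exact MeasurableSet.const ([] ∈ s)
  | succ k ih =>
    have : history I (k + 1) ⁻¹' s =
        ⋃ i, I k ⁻¹' {i} ∩ history I k ⁻¹' {l | i :: l ∈ s} := by
      ext a; simp [history]
    rw [this]
    exact MeasurableSet.iUnion fun i => (hI k (MeasurableSet.singleton i)).inter (ih _)

theorem measurable_comp_history (hI : ∀ t, Measurable (I t)) (g : List (Fin m) → ℝ) (k : ℕ) :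
    Measurable fun a => g (history I k a) :=
  fun s _ => measurableSet_history hI k (g ⁻¹' s)

/-- Only finitely many histories of length `k` exist, so any function of them is bounded. -/
theorem integrable_comp_history (hI : ∀ t, Measurable (I t)) (g : List (Fin m) → ℝ) (k : ℕ) :
    Integrable (fun a => g (history I k a)) Pr := by
  obtain ⟨c, hc⟩ := ((List.finite_length_eq (Fin m) k).image fun l => ‖g l‖).bddAbove
  exact Integrable.of_bound (measurable_comp_history hI g k).aestronglyMeasurable c
    (Filter.Eventually.of_forall fun a => hc ⟨_, length_history k a, rfl⟩)

/-- The tower property: the past depends only on draws before `k`, hence is independent of the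
uniform draw `I k`. -/
theorem integral_history_succ (hI : ∀ t, Measurable (I t)) (hindep : iIndepFun I Pr)
    (hunif : ∀ t i, Pr.real {a | I t a = i} = 1 / m) (g : List (Fin m) → ℝ) (k : ℕ) :
    ∫ a, g (history I (k + 1) a) ∂Pr =
      ∫ a, 1 / (m : ℝ) * ∑ i, g (i :: history I k a) ∂Pr := by
  -- With the discrete σ-algebra every function of the history is measurable.
  let _ : MeasurableSpace (List (Fin m)) := ⊤
  have hfac : ∃ φ : ((j : Finset.range k) → Fin m) → List (Fin m),
      history I k = φ ∘ fun a j => I j a := by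
    rw [← Function.factorsThrough_iff]
    intro a b hab
    have hab' : ∀ j < k, I j a = I j b := fun j hj =>
      congrFun hab (⟨j, Finset.mem_range.2 hj⟩ : Finset.range k)
    clear hab
    induction k with
    | zero => rfl
    | succ k ih =>
      simp only [history]
      rw [hab' k (Nat.lt_succ_self k), ih fun j hj => hab' j (hj.trans (Nat.lt_succ_self k))]
  obtain ⟨φ, hφ⟩ := hfac
  have hind : IndepFun (history I k) (I k) Pr := by
    have h := hindep.indepFun_finset (Finset.range k) {k} (by simp) hI
    have h' := h.comp (φ := φ)
      (ψ := fun t : ({k} : Finset ℕ) → Fin m => t ⟨k, Finset.mem_singleton_self k⟩)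
      (measurable_of_finite _) (measurable_of_finite _)
    rw [hφ]
    exact h'
  have hsplit : ∀ a, g (history I (k + 1) a) =
      ∑ i, g (i :: history I k a) * (if I k a = i then 1 else 0) := by
    intro a
    simp [history]
  have hprod : ∀ i, Integrable
      (fun a => g (i :: history I k a) * (if I k a = i then 1 else 0)) Pr := by
    intro i
    refine (integrable_comp_history (Pr := Pr) hI
      (fun l => g (i :: l.tail) * (if l.head? = some i then 1 else 0)) (k + 1)).congr ?_
    exact Filter.Eventually.of_forall fun a => by simp [history]
  simp_rw [hsplit]
  rw [integral_finsetSum _ fun i _ => hprod i, integral_const_mul,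
    integral_finsetSum _ fun i _ => integrable_comp_history hI (fun l => g (i :: l)) k,
    Finset.mul_sum]
  refine Finset.sum_congr rfl fun i _ => ?_
  have h1 : IndepFun (fun a => g (i :: history I k a)) (fun a => if I k a = i then (1 : ℝ) else 0)
      Pr :=
    hind.comp (φ := fun l => g (i :: l)) (ψ := fun j => if j = i then (1 : ℝ) else 0)
      measurable_from_top (measurable_of_finite _)
  have h2 := h1.integral_fun_mul_eq_mul_integral
    (integrable_comp_history hI (fun l => g (i :: l)) k).aestronglyMeasurable
    ((measurable_of_finite (fun j : Fin m => if j = i then (1 : ℝ) else 0)).comp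
      (hI k)).aestronglyMeasurable
  have h3 : ∫ a, (if I k a = i then (1 : ℝ) else 0) ∂Pr = 1 / m := by
    rw [← hunif k i]
    refine Eq.trans (integral_congr_ae (Filter.Eventually.of_forall fun a => ?_))
      (integral_indicator_one (μ := Pr) (hI k (MeasurableSet.singleton i)))
    simp [Set.indicator_apply]
  rw [h2, h3, mul_comm]

end Probability

end RPDG

namespace RPDG

/-! ### Scalar estimates and the parameter identities. -/

section Scalars

/-- With `q = α ^ (-1/2)` this bounds the total ergodic weight below by `k * α ^ (-k/2)`. The
induction step is Bernoulli's inequality. -/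
theorem mul_pow_le_sum_sq_pow {q : ℝ} (hq : 1 ≤ q) (k : ℕ) :
    k * q ^ k ≤ ∑ t ∈ Finset.Icc 1 k, (q ^ 2) ^ t := by
  induction k with
  | zero => simp
  | succ k ih =>
    rw [Finset.sum_Icc_succ_top (by omega)]
    have h1 := one_add_mul_le_pow (a := q - 1) (by linarith) (k + 1)
    rw [add_sub_cancel] at h1
    have h2 : 0 < q ^ k := by positivity
    have h3 : (q ^ 2) ^ (k + 1) = q ^ (k + 1) * q ^ (k + 1) := by ring
    have h4 : 1 ≤ q ^ (k + 1) := one_le_pow₀ hq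
    have h5 : q ^ (k + 1) = q ^ k * q := pow_succ q k
    rw [h3]
    push_cast at h1 ⊢
    have h6 : (k : ℝ) * (q - 1) * q ^ k ≤ (q ^ (k + 1) - 1) * q ^ (k + 1) := by
      have h7 : (k : ℝ) * (q - 1) ≤ q ^ (k + 1) - 1 := by nlinarith
      have h8 : q ^ k ≤ q ^ (k + 1) := pow_le_pow_right₀ hq (Nat.le_succ k)
      exact mul_le_mul h7 h8 h2.le (by linarith)
    nlinarith

/-- Rests on `log α ≤ α - 1`. For `M = 0` the claim holds whatever value the logarithm takes. -/
theorem rpow_mul_le_of_log_le {α M ε x : ℝ} (hα : 0 < α) (hα1 : α < 1) (hM : 0 ≤ M) (hε : 0 < ε)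
    (hx : 0 ≤ x) (h : (1 - α)⁻¹ * Real.log (M / ε) ≤ x) : α ^ x * M ≤ ε := by
  rcases hM.eq_or_lt with rfl | hM
  · simpa using hε.le
  have h1 := Real.log_le_sub_one_of_pos hα
  rw [inv_mul_le_iff₀ (by linarith)] at h
  have h2 : α ^ x ≤ ε / M := by
    rw [Real.rpow_def_of_pos hα, ← Real.le_log_iff_exp_le (by positivity), ← inv_div M ε,
      Real.log_inv]
    nlinarith
  rwa [le_div_iff₀ hM] at h2

variable {E : Type*} [NormedAddCommGroup E] [NormedSpace ℝ E] {m : ℕ} {Q : Problem m E}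
  {C τ η α : ℝ}

theorem const_nonneg (hC : C = 4 * m / Q.μ * ⨆ i, Q.L i) : 0 ≤ C := by
  rw [hC]
  have := Q.μ_pos
  exact mul_nonneg (by positivity) (Real.iSup_nonneg Q.L_nonneg)

theorem isParam_of_eq (hmL : 2 ≤ m ∨ ∃ i, 0 < Q.L i)
    (hC : C = 4 * m / Q.μ * ⨆ i, Q.L i)
    (hτ : τ = (√((m - 1) ^ 2 + 4 * m * C) - (m - 1)) / (2 * m))
    (hη : η = (Q.μ * √((m - 1) ^ 2 + 4 * m * C) + Q.μ * (m - 1)) / 2)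
    (hα : α = 1 - 2 / ((m + 1) + √((m - 1) ^ 2 + 4 * m * C))) : Q.IsParam τ η α := by
  have hm : 0 < m := by
    rcases hmL with h | ⟨i, _⟩
    · omega
    · exact i.pos
  have hm1 : (1 : ℝ) ≤ m := by exact_mod_cast hm
  have hμ := Q.μ_pos
  have hC0 : 0 ≤ C := const_nonneg hC
  have hLsup : ∀ i, Q.L i ≤ ⨆ i, Q.L i := le_ciSup (Set.finite_range Q.L).bddAbove
  have hμC : Q.μ * C = 4 * m * ⨆ i, Q.L i := by rw [hC]; field_simp
  set S := √((m - 1) ^ 2 + 4 * m * C) with hS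
  have hrad : 0 ≤ ((m : ℝ) - 1) ^ 2 + 4 * m * C := by positivity
  have hSsq : S ^ 2 = (m - 1) ^ 2 + 4 * m * C := Real.sq_sqrt hrad
  have hSge : (m : ℝ) - 1 ≤ S := by
    apply Real.le_sqrt_of_sq_le
    nlinarith [mul_nonneg (by linarith : (0 : ℝ) ≤ m) hC0]
  -- For `m = 1` and `L = 0` this sum would be zero, and with it `η` and `α`.
  have hSpos : 0 < S + (m - 1) := by
    rcases hmL with h | ⟨i, hi⟩
    · have : (2 : ℝ) ≤ m := by exact_mod_cast h
      linarith
    · have hCpos : 0 < C := by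
        have h1 : 0 < 4 * (m : ℝ) * ⨆ i, Q.L i := by
          have := hi.trans_le (hLsup i); positivity
        rw [← hμC] at h1
        exact pos_of_mul_pos_right h1 hμ.le
      have : 0 < S := Real.sqrt_pos.2 (by positivity)
      linarith
  have hden : 0 < (m + 1) + S := by linarith
  have hτm : (1 + τ) * m = (m + 1 + S) / 2 := by rw [hτ]; field_simp; ring
  have hα' : α = (S + (m - 1)) / ((m + 1) + S) := by rw [hα]; field_simp; ring
  refine ⟨hm, ?_, ?_, ?_, ?_, ?_, ?_, ?_, fun i => ?_⟩
  · rw [hτ]; exact div_nonneg (by linarith) (by linarith)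
  · rw [hη]
    have := mul_pos hμ hSpos
    linarith
  · rw [hα']; exact div_pos hSpos hden
  · rw [hα]; have : 0 < 2 / ((m + 1) + S) := by positivity
    linarith
  · rw [hη, hα']; field_simp; ring
  · rw [hτm, hα']; field_simp; ring
  · rw [hτm, hη]; ring
  -- The product is a difference of squares in `S` and `m - 1`; so `η * τ` equals `4 * m` times the
  -- largest `L i`.
  · have h1 : η * τ = Q.μ * C := by
      rw [hη, hτ]
      field_simp
      linear_combination hSsq
    rw [h1, hμC]
    exact mul_le_mul_of_nonneg_left (hLsup i) (by positivity)

end Scalars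

/-- Markov's inequality for the event `ε ≤ f`, which together with `f ≤ ε` covers the space. -/
theorem one_sub_le_measureReal_of_integral_le {Ω : Type*} [MeasurableSpace Ω] {Pr : Measure Ω}
    [IsProbabilityMeasure Pr] {f : Ω → ℝ} (hf : Integrable f Pr) (hf0 : ∀ a, 0 ≤ f a) {ε l : ℝ}
    (hε : 0 < ε) (h : ∫ a, f a ∂Pr ≤ l * ε) : 1 - l ≤ Pr.real {a | f a ≤ ε} := by
  have h1 := mul_meas_ge_le_integral_of_nonneg (Filter.Eventually.of_forall hf0) hf ε
  have h2 : Pr.real {a | ε ≤ f a} ≤ l := by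
    refine le_of_mul_le_mul_left ?_ hε
    linarith
  have h3 := measureReal_union_le (μ := Pr) {a | f a ≤ ε} {a | ε ≤ f a}
  have h4 : {a | f a ≤ ε} ∪ {a | ε ≤ f a} = univ := by
    ext a; simpa using le_total (f a) ε
  rw [h4, probReal_univ] at h3
  linarith

/-! ### Convergence rates in expectation. -/

section Rates

variable {E : Type*} [NormedAddCommGroup E] [NormedSpace ℝ E] {m : ℕ} {Q : Problem m E} {xs : E}
  {τ η α : ℝ} {x₀ : E} {w₀ : E →L[ℝ] ℝ} {R : List (Fin m) → State m E}
  {Ω : Type*} {I : ℕ → Ω → Fin m}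

theorem IsRun.half_sq_norm_le_proxDist {p : Fin m → ℝ} (hQ : Q.IsParam τ η α) (hxs : xs ∈ Q.X)
    (hR : IsRun Q p (fun _ => τ) (fun _ => η) (fun _ => α) x₀ w₀ R) (k : ℕ) (a : Ω) :
    1 / 2 * ‖iterate R I k a - xs‖ ^ 2 ≤ proxDist Q R I xs k a := by
  rw [norm_sub_rev]
  exact half_sq_norm_le_primalProxFun Q.strongConvex_ω
    (hR.isAdmissible hQ.τ_nonneg (history I k a)).subgrad hxs

theorem sum_inv_pow_pos (hα : 0 < α) {k : ℕ} (hk : 1 ≤ k) :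
    0 < ∑ t ∈ Finset.Icc 1 k, (α ^ t)⁻¹ :=
  Finset.sum_pos (fun t _ => by positivity) ⟨1, Finset.mem_Icc.2 ⟨le_rfl, hk⟩⟩

theorem iterate_mem {p : Fin m → ℝ} (hQ : Q.IsParam τ η α)
    (hR : IsRun Q p (fun _ => τ) (fun _ => η) (fun _ => α) x₀ w₀ R) (k : ℕ) (a : Ω) :
    iterate R I k a ∈ Q.X :=
  (hR.isAdmissible hQ.τ_nonneg (history I k a)).subgrad.1

theorem ergodicMean_mem {p : Fin m → ℝ} (hQ : Q.IsParam τ η α)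
    (hR : IsRun Q p (fun _ => τ) (fun _ => η) (fun _ => α) x₀ w₀ R) {k : ℕ} (hk : 1 ≤ k) (a : Ω) :
    ergodicMean R I α k a ∈ Q.X :=
  Q.convex_X.centerMass_mem (fun t _ => by have := hQ.α_pos; positivity)
    (sum_inv_pow_pos hQ.α_pos hk) fun t _ => iterate_mem hQ hR t a

theorem Psi_ergodicMean_sub_le {p : Fin m → ℝ} (hQ : Q.IsParam τ η α) (hxs : xs ∈ Q.X)
    (hR : IsRun Q p (fun _ => τ) (fun _ => η) (fun _ => α) x₀ w₀ R) {k : ℕ} (hk : 1 ≤ k) (a : Ω) :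
    Q.Psi (ergodicMean R I α k a) - Q.Psi xs ≤
      (∑ t ∈ Finset.Icc 1 k, (α ^ t)⁻¹)⁻¹ * ∑ t ∈ Finset.Icc 1 k,
        (α ^ t)⁻¹ * (Q.linGap xs (iterate R I t a) + Q.Lf * proxDist Q R I xs t a) := by
  have hα := hQ.α_pos
  refine (Q.Psi_sub_le xs _).trans <| ((Q.convexOn_linGap_add_sq xs).map_centerMass_le
    (t := Finset.Icc 1 k) (w := fun t => (α ^ t)⁻¹) (p := fun t => iterate R I t a)
    (fun t _ => by positivity) (sum_inv_pow_pos hα hk) fun t _ => iterate_mem hQ hR t a).trans ?_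
  rw [Finset.centerMass]
  simp only [smul_eq_mul, Function.comp_apply]
  refine mul_le_mul_of_nonneg_left (Finset.sum_le_sum fun t _ => ?_)
    (inv_nonneg.2 (sum_inv_pow_pos hα hk).le)
  refine mul_le_mul_of_nonneg_left ?_ (by positivity)
  have := mul_le_mul_of_nonneg_left (hR.half_sq_norm_le_proxDist (I := I) hQ hxs t a) Q.Lf_nonneg
  linarith

variable [MeasurableSpace Ω] {Pr : Measure Ω} [IsProbabilityMeasure Pr]

theorem integrable_proxDist (hI : ∀ t, Measurable (I t)) (k : ℕ) :
    Integrable (fun a => proxDist Q R I xs k a) Pr :=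
  integrable_comp_history hI (fun l => primalProxFun Q.ω (R l).w (R l).x xs) k

theorem integrable_linGap (hI : ∀ t, Measurable (I t)) (k : ℕ) :
    Integrable (fun a => Q.linGap xs (iterate R I k a)) Pr :=
  integrable_comp_history hI (fun l => Q.linGap xs (R l).x) k

theorem integrable_Psi_ergodicMean (hI : ∀ t, Measurable (I t)) (k : ℕ) :
    Integrable (fun a => Q.Psi (ergodicMean R I α k a) - Q.Psi xs) Pr := by
  refine (integrable_comp_history (Pr := Pr) hI (fun l => Q.Psi
    ((∑ t ∈ Finset.Icc 1 k, (α ^ t)⁻¹)⁻¹ •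
      ∑ t ∈ Finset.Icc 1 k, (α ^ t)⁻¹ • (R (l.drop (k - t))).x) - Q.Psi xs) k).congr ?_
  refine Filter.Eventually.of_forall fun a => ?_
  simp only [ergodicMean]
  congr 3
  refine Finset.sum_congr rfl fun t ht => ?_
  rw [iterate, history_eq_drop (Finset.mem_Icc.1 ht).2]

/-- The recursion for the expected potential, weighted and summed over `k` iterations. -/
theorem weighted_potential_le (hQ : Q.IsParam τ η α) (hxs : xs ∈ Q.X)
    (hR : IsRun Q (fun _ => 1 / (m : ℝ)) (fun _ => τ) (fun _ => η) (fun _ => α) x₀ w₀ R)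
    (hI : ∀ t, Measurable (I t)) (hindep : iIndepFun I Pr)
    (hunif : ∀ t i, Pr.real {a | I t a = i} = 1 / m) (k : ℕ) :
    (α ^ k)⁻¹ * ∫ a, Q.potential xs τ η (R (history I k a)) ∂Pr +
      ∑ t ∈ Finset.Icc 1 k, (α ^ t)⁻¹ * ∫ a, Q.linGap xs (iterate R I t a) ∂Pr ≤
    Q.potential xs τ η (R []) := by
  have hα := hQ.α_pos
  induction k with
  | zero => simp [history]
  | succ k ih =>
    refine le_trans ?_ ih
    rw [Finset.sum_Icc_succ_top (by omega)]
    have h1 : ∫ a, Q.linGap xs (iterate R I (k + 1) a) ∂Pr +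
        ∫ a, Q.potential xs τ η (R (history I (k + 1) a)) ∂Pr ≤
        α * ∫ a, Q.potential xs τ η (R (history I k a)) ∂Pr := by
      rw [← integral_add (integrable_linGap hI (k + 1))
        (integrable_comp_history hI (fun l => Q.potential xs τ η (R l)) (k + 1)),
        ← integral_const_mul]
      have h2 := integral_history_succ (Pr := Pr) hI hindep hunif
        (fun l => Q.linGap xs (R l).x + Q.potential xs τ η (R l)) k
      refine (le_of_eq h2).trans (integral_mono ?_ ?_ fun a => ?_)
      · exact integrable_comp_history hI (fun l => 1 / (m : ℝ) *
          ∑ i, (Q.linGap xs (R (i :: l)).x + Q.potential xs τ η (R (i :: l)))) k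
      · exact integrable_comp_history hI (fun l => α * Q.potential xs τ η (R l)) k
      · exact sum_potential_step hQ hxs (hR.isAdmissible hQ.τ_nonneg _) (hR.step _)
    have h3 : (α ^ k)⁻¹ = (α ^ (k + 1))⁻¹ * α := by
      rw [pow_succ, mul_inv, inv_mul_cancel_right₀ hα.ne']
    have h4 : 0 ≤ (α ^ (k + 1))⁻¹ := by positivity
    rw [h3]
    nlinarith [mul_le_mul_of_nonneg_left h1 h4]

theorem integral_proxDist_le (hQ : Q.IsParam τ η α) (hxs : xs ∈ Q.X) (hopt : IsMinOn Q.Psi Q.X xs)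
    (hR : IsRun Q (fun _ => 1 / (m : ℝ)) (fun _ => τ) (fun _ => η) (fun _ => α) x₀ w₀ R)
    (hI : ∀ t, Measurable (I t)) (hindep : iIndepFun I Pr)
    (hunif : ∀ t i, Pr.real {a | I t a = i} = 1 / m) (k : ℕ) :
    ∫ a, proxDist Q R I xs k a ∂Pr ≤
      (1 + Q.Lf / Q.μ) * α ^ k * primalProxFun Q.ω w₀ x₀ xs := by
  have hα := hQ.α_pos
  have h1 := (weighted_potential_le hQ hxs hR hI hindep hunif k).trans
    (hR.potential_nil_le hQ hxs)
  have h2 : 0 ≤ ∑ t ∈ Finset.Icc 1 k,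
      (α ^ t)⁻¹ * ∫ a, Q.linGap xs (iterate R I t a) ∂Pr :=
    Finset.sum_nonneg fun t _ => mul_nonneg (by positivity) <|
      integral_nonneg fun a => Problem.linGap_nonneg hxs hopt (iterate_mem hQ hR t a)
  have h3 : (Q.μ + η) * ∫ a, proxDist Q R I xs k a ∂Pr ≤
      ∫ a, Q.potential xs τ η (R (history I k a)) ∂Pr := by
    rw [← integral_const_mul]
    exact integral_mono ((integrable_proxDist hI k).const_mul _)
      (integrable_comp_history hI (fun l => Q.potential xs τ η (R l)) k)
      fun a => primalProxFun_le_potential hQ (hR.isAdmissible hQ.τ_nonneg _)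
  have h4 : (α ^ k)⁻¹ * ∫ a, Q.potential xs τ η (R (history I k a)) ∂Pr ≤
      (Q.μ + η) * ((1 + Q.Lf / Q.μ) * primalProxFun Q.ω w₀ x₀ xs) := by linarith
  rw [inv_mul_le_iff₀ (by positivity)] at h4
  have hpos : 0 < Q.μ + η := add_pos Q.μ_pos hQ.η_pos
  refine le_of_mul_le_mul_left ?_ hpos
  linarith

/-- The weighted `linGap` sum is at most the initial potential and the distance terms add at most `k
* (Lf * M)`. Dividing by the total weight `A ≥ k * α ^ (-k/2)` leaves the rate `α ^ (k/2)`. -/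
theorem integral_Psi_sub_le (hQ : Q.IsParam τ η α) (hxs : xs ∈ Q.X) (hopt : IsMinOn Q.Psi Q.X xs)
    (hR : IsRun Q (fun _ => 1 / (m : ℝ)) (fun _ => τ) (fun _ => η) (fun _ => α) x₀ w₀ R)
    (hI : ∀ t, Measurable (I t)) (hindep : iIndepFun I Pr)
    (hunif : ∀ t i, Pr.real {a | I t a = i} = 1 / m) {k : ℕ} (hk : 1 ≤ k) :
    ∫ a, (Q.Psi (ergodicMean R I α k a) - Q.Psi xs) ∂Pr ≤
      α ^ ((k : ℝ) / 2) * (1 - α)⁻¹ * (Q.μ + 2 * Q.Lf + Q.Lf ^ 2 / Q.μ) *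
        primalProxFun Q.ω w₀ x₀ xs := by
  have hα := hQ.α_pos
  have hμ := Q.μ_pos
  have hLf := Q.Lf_nonneg
  have hα1 : 0 < 1 - α := sub_pos.2 hQ.α_lt_one
  have hP₀ : 0 ≤ primalProxFun Q.ω w₀ x₀ xs :=
    le_trans (by positivity) (half_sq_norm_le_primalProxFun Q.strongConvex_ω hR.w₀_mem hxs)
  set M := (1 + Q.Lf / Q.μ) * primalProxFun Q.ω w₀ x₀ xs with hM
  have hM0 : 0 ≤ M := by positivity
  set A := ∑ t ∈ Finset.Icc 1 k, (α ^ t)⁻¹ with hA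
  have hA0 : 0 < A := sum_inv_pow_pos hα hk
  have h1 : ∫ a, (Q.Psi (ergodicMean R I α k a) - Q.Psi xs) ∂Pr ≤ A⁻¹ *
      ∑ t ∈ Finset.Icc 1 k, (α ^ t)⁻¹ * (∫ a, Q.linGap xs (iterate R I t a) ∂Pr +
        Q.Lf * ∫ a, proxDist Q R I xs t a ∂Pr) := by
    have hint : ∀ t, Integrable (fun a => Q.linGap xs (iterate R I t a) +
        Q.Lf * proxDist Q R I xs t a) Pr := fun t =>
      (integrable_linGap hI t).add ((integrable_proxDist hI t).const_mul _)
    refine (integral_mono (integrable_Psi_ergodicMean hI k)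
      ((integrable_finsetSum _ fun t _ => (hint t).const_mul _).const_mul _)
      fun a => Psi_ergodicMean_sub_le hQ hxs hR hk a).trans (le_of_eq ?_)
    rw [integral_const_mul, integral_finsetSum _ fun t _ => (hint t).const_mul _]
    congr 1
    refine Finset.sum_congr rfl fun t _ => ?_
    rw [integral_const_mul, integral_add (integrable_linGap hI t)
      ((integrable_proxDist hI t).const_mul _), integral_const_mul]
  have h2 : ∑ t ∈ Finset.Icc 1 k, (α ^ t)⁻¹ * ∫ a, Q.linGap xs (iterate R I t a) ∂Pr ≤
      (Q.μ + η) * M := by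
    refine le_trans ?_ ((weighted_potential_le hQ hxs hR hI hindep hunif k).trans
      (hR.potential_nil_le hQ hxs))
    refine le_add_of_nonneg_left (mul_nonneg (by positivity) (integral_nonneg fun a => ?_))
    refine le_trans (mul_nonneg (add_pos hμ hQ.η_pos).le ?_)
      (primalProxFun_le_potential hQ (hR.isAdmissible hQ.τ_nonneg _))
    exact le_trans (by positivity) (hR.half_sq_norm_le_proxDist (I := I) hQ hxs k a)
  have h3 : ∑ t ∈ Finset.Icc 1 k, (α ^ t)⁻¹ * (Q.Lf * ∫ a, proxDist Q R I xs t a ∂Pr) ≤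
      k * (Q.Lf * M) := by
    -- The weight cancels the decay `α ^ t`, so every iteration contributes the same bound.
    have : ∀ t ∈ Finset.Icc 1 k, (α ^ t)⁻¹ * (Q.Lf * ∫ a, proxDist Q R I xs t a ∂Pr) ≤
        Q.Lf * M := fun t _ => by
      have h := integral_proxDist_le hQ hxs hopt hR hI hindep hunif t
      rw [inv_mul_le_iff₀ (by positivity)]
      refine (mul_le_mul_of_nonneg_left h hLf).trans (le_of_eq ?_)
      rw [hM]; ring
    refine (Finset.sum_le_card_nsmul _ _ _ this).trans (le_of_eq ?_)
    simp
  have hr : α ^ ((k : ℝ) / 2) = √α ^ k := by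
    rw [Real.rpow_div_two_eq_sqrt _ hα.le, Real.rpow_natCast]
  have hr0 : 0 < √α := Real.sqrt_pos.2 hα
  have hr1 : √α ≤ 1 := Real.sqrt_le_one.2 hQ.α_lt_one.le
  have h4 : k * (√α ^ k)⁻¹ ≤ A := by
    have h := mul_pow_le_sum_sq_pow ((one_le_inv₀ hr0).2 hr1) k
    simpa only [inv_pow, Real.sq_sqrt hα.le] using h
  have hk1 : (1 : ℝ) ≤ k := by exact_mod_cast hk
  have h5 : A⁻¹ * k ≤ √α ^ k := by
    rw [inv_mul_le_iff₀ hA0]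
    rwa [← div_eq_mul_inv, div_le_iff₀ (by positivity)] at h4
  have h6 : A⁻¹ ≤ √α ^ k := by
    refine le_trans ?_ h5
    exact le_mul_of_one_le_right (inv_pos.2 hA0).le hk1
  -- This identity is the origin of the factor `(1 - α)⁻¹` in the rate.
  have h7 : (1 - α) * (Q.μ + η) = Q.μ := by linear_combination hQ.η_eq
  have h8 : Q.μ + η = (1 - α)⁻¹ * Q.μ := by rw [eq_inv_mul_iff_mul_eq₀ hα1.ne', h7]
  have h9 : 1 ≤ (1 - α)⁻¹ := (one_le_inv₀ hα1).2 (by linarith)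
  have h10 : (Q.μ + 2 * Q.Lf + Q.Lf ^ 2 / Q.μ) * primalProxFun Q.ω w₀ x₀ xs =
      (Q.μ + Q.Lf) * M := by rw [hM]; field_simp; ring
  rw [hr, mul_assoc, h10]
  refine h1.trans ?_
  simp only [mul_add, Finset.sum_add_distrib]
  have h11 : A⁻¹ * ((Q.μ + η) * M) ≤ √α ^ k * ((Q.μ + η) * M) :=
    mul_le_mul_of_nonneg_right h6 (mul_nonneg (add_pos hμ hQ.η_pos).le hM0)
  have h12 : A⁻¹ * k * (Q.Lf * M) ≤ √α ^ k * (1 - α)⁻¹ * (Q.Lf * M) :=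
    mul_le_mul_of_nonneg_right (h5.trans (le_mul_of_one_le_right (by positivity) h9))
      (by positivity)
  have h13 := mul_le_mul_of_nonneg_left h2 (inv_pos.2 hA0).le
  have h14 := mul_le_mul_of_nonneg_left h3 (inv_pos.2 hA0).le
  rw [h8] at h11 h13
  linarith

end Rates

end RPDG

/-! ### Iteration bounds and their order. -/

theorem corollary3p2 {m : ℕ} {E : Type*} [NormedAddCommGroup E] [NormedSpace ℝ E]
    [FiniteDimensional ℝ E] (Q : RPDG.Problem m E)
    -- the case `m = 1`, `L = 0`, in which `α = 0`, is excluded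
    (hmL : 2 ≤ m ∨ ∃ i, 0 < Q.L i)
    -- an optimal solution
    (xs : E) (hxs : xs ∈ Q.X) (hopt : IsMinOn Q.Psi Q.X xs)
    -- the parameters
    (C τ η α : ℝ)
    (hC : C = 4 * m / Q.μ * ⨆ i, Q.L i)
    (hτ : τ = (√((m - 1) ^ 2 + 4 * m * C) - (m - 1)) / (2 * m))
    (hη : η = (Q.μ * √((m - 1) ^ 2 + 4 * m * C) + Q.μ * (m - 1)) / 2)
    (hα : α = 1 - 2 / ((m + 1) + √((m - 1) ^ 2 + 4 * m * C)))
    -- a run of the method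
    (x₀ : E) (w₀ : E →L[ℝ] ℝ) (R : List (Fin m) → RPDG.State m E)
    (hR : RPDG.IsRun Q (fun _ => 1 / (m : ℝ)) (fun _ => τ) (fun _ => η) (fun _ => α) x₀ w₀ R)
    -- independent uniformly distributed indices
    {Ω : Type*} [MeasurableSpace Ω] (Pr : Measure Ω) [IsProbabilityMeasure Pr]
    (I : ℕ → Ω → Fin m) (hI : ∀ t, Measurable (I t)) (hindep : iIndepFun I Pr)
    (hunif : ∀ t i, Pr.real {a | I t a = i} = 1 / m)
    -- the number `P(x⁰, x*)`
    (P₀ : ℝ) (hP₀ : P₀ = RPDG.primalProxFun Q.ω w₀ x₀ xs) :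
    -- convergence in terms of the prox-distance
    (∀ k : ℕ, 1 ≤ k →
      Integrable (fun a => RPDG.proxDist Q R I xs k a) Pr ∧
      ∫ a, RPDG.proxDist Q R I xs k a ∂Pr ≤ (1 + Q.Lf / Q.μ) * α ^ k * P₀) ∧
    -- convergence in terms of the primal gap of the ergodic mean
    (∀ k : ℕ, 1 ≤ k →
      Integrable (fun a => Q.Psi (RPDG.ergodicMean R I α k a) - Q.Psi xs) Pr ∧
      ∫ a, (Q.Psi (RPDG.ergodicMean R I α k a) - Q.Psi xs) ∂Pr ≤
        α ^ ((k : ℝ) / 2) * (1 - α)⁻¹ * (Q.μ + 2 * Q.Lf + Q.Lf ^ 2 / Q.μ) * P₀) ∧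
    -- iteration bounds in terms of the prox-distance
    (∀ ε : ℝ, 0 < ε → ∀ k : ℕ, RPDG.Ku m Q.μ Q.Lf P₀ ε C ≤ k →
      ∫ a, RPDG.proxDist Q R I xs k a ∂Pr ≤ ε) ∧
    (∀ ε l : ℝ, 0 < ε → 0 < l → l < 1 → ∀ k : ℕ, RPDG.Ku m Q.μ Q.Lf P₀ (l * ε) C ≤ k →
      1 - l ≤ Pr.real {a | RPDG.proxDist Q R I xs k a ≤ ε}) ∧
    -- iteration bounds in terms of the primal gap
    (∀ ε : ℝ, 0 < ε → ∀ k : ℕ, 1 ≤ k → RPDG.Ktilde m Q.μ Q.Lf P₀ ε C / 2 ≤ k →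
      ∫ a, (Q.Psi (RPDG.ergodicMean R I α k a) - Q.Psi xs) ∂Pr ≤ ε) ∧
    (∀ ε l : ℝ, 0 < ε → 0 < l → l < 1 → ∀ k : ℕ, 1 ≤ k →
      RPDG.Ktilde m Q.μ Q.Lf P₀ (l * ε) C / 2 ≤ k →
      1 - l ≤ Pr.real {a | Q.Psi (RPDG.ergodicMean R I α k a) - Q.Psi xs ≤ ε}) ∧
    -- order of the iteration bounds
    (∀ ε : ℝ, 0 < ε → ε ≤ (1 + Q.Lf / Q.μ) * P₀ →
      RPDG.Ku m Q.μ Q.Lf P₀ ε C ≤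
        (m + √(m * C)) * Real.log ((1 + Q.Lf / Q.μ) * (P₀ / ε))) ∧
    (∀ ε : ℝ, 0 < ε → ε ≤ 2 * (Q.μ + 2 * Q.Lf + Q.Lf ^ 2 / Q.μ) * (m + √(m * C)) * P₀ →
      RPDG.Ktilde m Q.μ Q.Lf P₀ ε C / 2 ≤
        2 * (m + √(m * C)) *
          Real.log (2 * (Q.μ + 2 * Q.Lf + Q.Lf ^ 2 / Q.μ) * (m + √(m * C)) * (P₀ / ε))) := by
  have hQ := RPDG.isParam_of_eq hmL hC hτ hη hα
  have hC0 := RPDG.const_nonneg hC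
  have hm1 : (1 : ℝ) ≤ m := by exact_mod_cast hQ.m_pos
  have hμ := Q.μ_pos
  have hLf := Q.Lf_nonneg
  have hα1 : 0 < 1 - α := sub_pos.2 hQ.α_lt_one
  have hP₀' : 0 ≤ P₀ := hP₀ ▸ le_trans (by positivity)
    (RPDG.half_sq_norm_le_primalProxFun Q.strongConvex_ω hR.w₀_mem hxs)
  have hprox := RPDG.integral_proxDist_le (Pr := Pr) hQ hxs hopt hR hI hindep hunif
  have hgap := fun {k : ℕ} (hk : 1 ≤ k) =>
    RPDG.integral_Psi_sub_le (Pr := Pr) hQ hxs hopt hR hI hindep hunif hk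
  rw [← hP₀] at hprox hgap
  have hprox_int := RPDG.integrable_proxDist (Pr := Pr) (Q := Q) (xs := xs) (R := R) hI
  have hgap_int := RPDG.integrable_Psi_ergodicMean (Pr := Pr) (Q := Q) (xs := xs) (R := R)
    (α := α) hI
  set S := √(((m : ℝ) - 1) ^ 2 + 4 * m * C) with hS
  have hS0 : 0 ≤ S := Real.sqrt_nonneg _
  have hinv : (1 - α)⁻¹ = ((m + 1) + S) / 2 := by rw [hα]; field_simp; ring
  -- Subadditivity of the square root, applied to the radicand of `S`.
  have hSle : ((m + 1) + S) / 2 ≤ m + √(m * C) := by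
    have h1 : S ≤ (m - 1) + 2 * √(m * C) := by
      have h2 : 0 ≤ √(m * C) := Real.sqrt_nonneg _
      have h3 : √(m * C) ^ 2 = m * C := Real.sq_sqrt (by positivity)
      refine Real.sqrt_le_iff.2 ⟨by linarith, ?_⟩
      nlinarith [mul_nonneg (by linarith : (0 : ℝ) ≤ m - 1) h2]
    linarith
  set B := m + √(m * C) with hB
  have hB0 : 0 ≤ B := by positivity
  set N := Q.μ + 2 * Q.Lf + Q.Lf ^ 2 / Q.μ with hN
  have hN0 : 0 ≤ N := by positivity
  have hKu : ∀ ε : ℝ, 0 < ε → ∀ k : ℕ, RPDG.Ku m Q.μ Q.Lf P₀ ε C ≤ k →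
      ∫ a, RPDG.proxDist Q R I xs k a ∂Pr ≤ ε := by
    intro ε hε k hk
    rw [RPDG.Ku, ← hS, ← hinv, ← mul_div_assoc] at hk
    have h := RPDG.rpow_mul_le_of_log_le hQ.α_pos hQ.α_lt_one (by positivity) hε
      (Nat.cast_nonneg k) hk
    rw [Real.rpow_natCast] at h
    refine (hprox k).trans (le_trans (le_of_eq ?_) h)
    ring
  have hKt : ∀ ε : ℝ, 0 < ε → ∀ k : ℕ, 1 ≤ k → RPDG.Ktilde m Q.μ Q.Lf P₀ ε C / 2 ≤ k →
      ∫ a, (Q.Psi (RPDG.ergodicMean R I α k a) - Q.Psi xs) ∂Pr ≤ ε := by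
    intro ε hε k hk1 hk
    have hk' : (1 - α)⁻¹ * Real.log (2 * N * B * P₀ / ε) ≤ (k : ℝ) / 2 := by
      rw [RPDG.Ktilde, ← hS, ← hB, ← hN, ← mul_div_assoc] at hk
      rw [hinv]
      linarith
    have h := RPDG.rpow_mul_le_of_log_le hQ.α_pos hQ.α_lt_one (by positivity) hε
      (by positivity) hk'
    refine (hgap hk1).trans (le_trans ?_ h)
    have h1 : 0 ≤ α ^ ((k : ℝ) / 2) := Real.rpow_nonneg hQ.α_pos.le _
    -- The factor `2 * B` inside the logarithm of `Ktilde` pays for the prefactor `(1 - α)⁻¹` of the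
    -- rate.
    have h2 : (1 - α)⁻¹ ≤ 2 * B := by rw [hinv]; linarith
    have h3 := mul_le_mul_of_nonneg_left h2 (by positivity : 0 ≤ α ^ ((k : ℝ) / 2) * (N * P₀))
    linarith
  refine ⟨fun k _ => ⟨hprox_int k, hprox k⟩, fun k hk => ⟨hgap_int k, hgap hk⟩, hKu,
    fun ε l hε hl _ k hk => ?_, hKt, fun ε l hε hl _ k hk1 hk => ?_, fun ε hε h => ?_,
    fun ε hε h => ?_⟩
  · exact RPDG.one_sub_le_measureReal_of_integral_le (hprox_int k)
      (fun a => le_trans (by positivity) (hR.half_sq_norm_le_proxDist hQ hxs k a)) hε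
      (hKu _ (mul_pos hl hε) k hk)
  · exact RPDG.one_sub_le_measureReal_of_integral_le (hgap_int k)
      (fun a => sub_nonneg.2 (hopt (RPDG.ergodicMean_mem hQ hR hk1 a))) hε
      (hKt _ (mul_pos hl hε) k hk1 hk)
  · rw [RPDG.Ku, ← hS]
    refine mul_le_mul_of_nonneg_right hSle (Real.log_nonneg ?_)
    rw [← mul_div_assoc, one_le_div hε]
    exact h
  · have hlog : 0 ≤ Real.log (2 * N * B * (P₀ / ε)) := by
      refine Real.log_nonneg ?_
      rw [← mul_div_assoc, one_le_div hε]
      exact h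
    rw [RPDG.Ktilde, ← hS, ← hB, ← hN]
    nlinarith [mul_le_mul_of_nonneg_right hSle hlog]
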